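/- Let $p$ be a prime of the form $p=8q+5$ with $q>0$ an integer, let $R_4=\{z^4 : z\in\mathbb Z_p^*\}$, and let $\mathcal S=\{g_1,\dots,g_m\}\subset\mathbb Z_p$ be nonempty with $m$ elements. Let $\mathcal F=\{f_x\}_{x\in\mathbb Z_p}$, where $f_x=\frac1{\sqrt m}\left(e^{2\pi i g_jx/p}\right)_{j=1}^m\in\mathbb C^m$, be the harmonic frame generated by $\mathcal S$. A family $\{f_x\}$ spanning $\mathbb C^m$ with $\|f_x\|=1$ for all $x$ and $\sum_x f_xf_x^*=cI_m$ for some $c>0$ is called an equiangular (respectively, biangular) tight frame if its set of frame angles $\{|\langle f_x,f_y\rangle| : x\ne y\}$ has exactly one (respectively, exactly two) elements. A frame angle $\alpha$ has multiplicity $\tau$ if, for every $x$, there are exactly $\tau$ indices $y\neq x$ with $|\langle f_x,f_y\rangle|=\alpha$. 1. If $\mathcal S=R_4$ and $p=4a^2+1$ for some odd integer $a$, then $\mathcal F$ is an equiangular tight frame. 2. If $\mathcal S=R_4\cup\{0\}$ and $p=4a^2+9$ for some odd integer $a$, then $\mathcal F$ is an equiangular tight frame. 3. If $\mathcal S=R_4$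 and $p=9+4a^2$ or $p=25+4a^2$ for some integer $a$, then $\mathcal F$ is a biangular tight frame whose two frame angles are $$\frac1{p-1}\sqrt{3p+1+8\sqrt p}\quad\text{and}\quad\frac1{p-1}\sqrt{3p+1-8\sqrt p},$$ each of multiplicity $\frac{p-1}2$. 4. If $\mathcal S=R_4\cup\{0\}$ and $p=1+4a^2$ or $p=49+4a^2$ for some integer $a$, then $\mathcal F$ is a biangular tight frame whose two frame angles are $$\frac1{p+3}\sqrt{3p+9+8\sqrt p}\quad\text{and}\quad\frac1{p+3}\sqrt{3p+9-8\sqrt p},$$ each of multiplicity $\frac{p-1}2$. -/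

import Mathlib

noncomputable section

/-- A finite family of vectors in `ℂ^m` is a frame if it spans `ℂ^m`. -/
def IsFrame {ι : Type*} {m : ℕ} (f : ι → EuclideanSpace ℂ (Fin m)) : Prop :=
  Submodule.span ℂ (Set.range f) = ⊤

/-- Every vector of the family has norm one. -/
def IsUnitNorm {ι : Type*} {m : ℕ} (f : ι → EuclideanSpace ℂ (Fin m)) : Prop :=
  ∀ j, ‖f j‖ = 1

/-- `∑ j, f_j ⊗ f_j^* = a I` for some real `a > 0`; here `rankOne ℂ x y` is the operator
`z ↦ ⟪y, z⟫ x`, that is, `x ⊗ y^*`. -/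
def IsTight {ι : Type*} [Fintype ι] {m : ℕ} (f : ι → EuclideanSpace ℂ (Fin m)) : Prop :=
  ∃ a : ℝ, 0 < a ∧
    ∑ j, InnerProductSpace.rankOne ℂ (f j) (f j) =
      (a : ℂ) • ContinuousLinearMap.id ℂ (EuclideanSpace ℂ (Fin m))

/-- The set of frame angles `|⟨f_j, f_j'⟩|`, `j ≠ j'`. -/
def frameAngles {ι : Type*} {m : ℕ} (f : ι → EuclideanSpace ℂ (Fin m)) : Set ℝ :=
  {r | ∃ j j', j ≠ j' ∧ ‖inner ℂ (f j) (f j')‖ = r}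

/-- The family has exactly `d` distinct frame angles. -/
def IsAngular {ι : Type*} {m : ℕ} (d : ℕ) (f : ι → EuclideanSpace ℂ (Fin m)) : Prop :=
  (frameAngles f).encard = d

/-- Unit-norm tight frames with exactly `d` frame angles. -/
structure IsAngularTightFrame {ι : Type*} [Fintype ι] {m : ℕ} (d : ℕ)
    (f : ι → EuclideanSpace ℂ (Fin m)) : Prop where
  isFrame : IsFrame f
  isUnitNorm : IsUnitNorm f
  isTight : IsTight f
  isAngular : IsAngular d f

/-- Equiangular tight frames. -/
def IsETF {ι : Type*} [Fintype ι] {m : ℕ} (f : ι → EuclideanSpace ℂ (Fin m)) : Prop :=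
  IsAngularTightFrame 1 f

/-- Biangular tight frames. -/
def IsBTF {ι : Type*} [Fintype ι] {m : ℕ} (f : ι → EuclideanSpace ℂ (Fin m)) : Prop :=
  IsAngularTightFrame 2 f

/-- `τ` is the multiplicity of `α`: for every `j` there are exactly `τ` indices `j' ≠ j`
with `|⟨f_j, f_j'⟩| = α`. -/
def HasMultiplicity {ι : Type*} {m : ℕ} (f : ι → EuclideanSpace ℂ (Fin m))
    (α : ℝ) (τ : ℕ) : Prop :=
  ∀ j, {j' | j' ≠ j ∧ ‖inner ℂ (f j) (f j')‖ = α}.encard = τ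

/-- The `ℤ_n`-harmonic frame for `ℂ^m` generated by `S = {g_1, …, g_m}`, the enumeration being
given as a bijection: `f_x = (1 / √m) (ρ_{g_j}(x))_j`, where `ρ_g(x) = exp(2 π i g x / n)`. -/
def harmonicFrame {n m : ℕ} [NeZero n] {S : Set (ZMod n)} (g : Fin m ≃ S) :
    ZMod n → EuclideanSpace ℂ (Fin m) :=
  fun x => WithLp.toLp 2 fun j =>
    (1 / (Real.sqrt m : ℂ)) * ZMod.stdAddChar ((g j : ZMod n) * x)

/-- The set of `s`-th power residues in the multiplicative group of `ℤ_p`. -/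
def residues (p s : ℕ) : Set (ZMod p) :=
  {x | ∃ z : (ZMod p)ˣ, x = ((z ^ s : (ZMod p)ˣ) : ZMod p)}

end

/-! Up to the factor 1/m, an inner product of the frame is a quartic Gauss period, plus 1 if 0 is
adjoined. With χ a quartic character and w = G(χ), the period is a quarter of -1 + w + G(χ²) +
G(χ⁻¹). Since p ≡ 5 mod 8, χ(-1) = -1, so G(χ⁻¹) = -conj w and G(χ²) = ε√p with ε = ±1: the real
part is explicit and the imaginary part comes from Im w. From w² = -J(χ, χ²) G(χ²) and |w|² = p one
gets (2 Im w)² = 2p + 2ε√p x, where x = Re J.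

Adding c = 0 or 4 for the absence or presence of 0, the squared modulus is 3p + (c-1)² + 2ε(x+c-1)√p
(`exists_norm_inner_harmonicFrame`). The frame is thus equiangular when x = 1 - c, and the stated
biangular values arise when x + c - 1 = ±4.

To identify x: |J|² = p and a congruence for J give p = x² + 4y² with x ≡ 1 mod 4
(`exists_jacobiSum_quartic_eq`). Such an x is unique, so each shape of p in the theorem determines
it. -/

/-! ### Representations of a prime as x² + 4y² -/

/-- Uniqueness of the representation of a prime as `x² + 4y²`. -/
lemma sq_eq_sq_of_prime_eq_sq_add_four_mul_sq {p : ℕ} (hp : p.Prime) {x y c a : ℤ}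
    (h : (p : ℤ) = x ^ 2 + 4 * y ^ 2) (h' : (p : ℤ) = c ^ 2 + 4 * a ^ 2) : x ^ 2 = c ^ 2 := by
  have hp0 : (0 : ℤ) < p := by exact_mod_cast hp.pos
  have key : ∀ b : ℤ, b ^ 2 = a ^ 2 → (p : ℤ) ∣ x * b - c * y → x ^ 2 = c ^ 2 := by
    rintro b hb ⟨k, hk⟩
    -- Brahmagupta's identity; as the last difference is pk, a nonzero k would make the right side
    -- at least 4p².
    have e : (p : ℤ) ^ 2 = (x * c + 4 * (b * y)) ^ 2 + 4 * (x * b - c * y) ^ 2 := by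
      have h'' : (p : ℤ) = c ^ 2 + 4 * b ^ 2 := by rw [hb]; exact h'
      calc (p : ℤ) ^ 2 = (x ^ 2 + 4 * y ^ 2) * (c ^ 2 + 4 * b ^ 2) := by rw [← h, ← h'']; ring
        _ = _ := by ring
    have hk0 : k = 0 := by
      by_contra hne
      have h1 : 1 ≤ k ^ 2 := by
        have := sq_pos_of_ne_zero hne
        omega
      rw [hk] at e
      nlinarith [sq_nonneg (x * c + 4 * (b * y)), mul_pos hp0 hp0,
        mul_le_mul_of_nonneg_left h1 (sq_nonneg (p : ℤ))]
    have hz : x * b = c * y := by rw [hk0, mul_zero] at hk; linarith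
    have h2 : (p : ℤ) * (a ^ 2 - y ^ 2) = 0 := by
      have : (x * b) ^ 2 = (c * y) ^ 2 := by rw [hz]
      have h3 : x ^ 2 * a ^ 2 = c ^ 2 * y ^ 2 := by rw [← hb]; linarith [mul_pow x b 2, mul_pow c y 2]
      have hx : x ^ 2 = p - 4 * y ^ 2 := by linarith
      have hc : c ^ 2 = p - 4 * a ^ 2 := by linarith
      rw [hx, hc] at h3
      linarith
    rcases mul_eq_zero.1 h2 with h3 | h3
    · exact absurd h3 hp0.ne'
    · linarith
  -- Modulo p, (xa)² ≡ (cy)², so p divides one factor; the two factors differ by the sign of a.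
  have hd : (p : ℤ) ∣ (x * a - c * y) * (x * (-a) - c * y) := by
    refine ⟨y ^ 2 - a ^ 2, ?_⟩
    have hx : x ^ 2 = p - 4 * y ^ 2 := by linarith
    have hc : c ^ 2 = p - 4 * a ^ 2 := by linarith
    calc _ = c ^ 2 * y ^ 2 - x ^ 2 * a ^ 2 := by ring
      _ = _ := by rw [hx, hc]; ring
  rcases (Nat.prime_iff_prime_int.1 hp).dvd_or_dvd hd with h1 | h1
  · exact key a rfl h1
  · exact key (-a) (by ring) h1

lemma Int.eq_of_sq_eq_sq_of_emod_four {x c : ℤ} (hx : x % 4 = 1) (hc : c % 4 = 1)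
    (h : x ^ 2 = c ^ 2) : x = c := by
  rcases sq_eq_sq_iff_eq_or_eq_neg.1 h with h | h
  · exact h
  · omega

/-! ### Quartic characters and their Jacobi sums -/

/-- For a prime `p ≡ 5 mod 8` there is a quartic character of `ZMod p`; it is odd, and its kernel
consists of the fourth powers. -/
lemma exists_quartic_mulChar {p q : ℕ} [Fact p.Prime] (hp : p = 8 * q + 5) :
    ∃ χ : MulChar (ZMod p) ℂ, χ ^ 4 = 1 ∧ χ ^ 2 ≠ 1 ∧ χ (-1) = -1 ∧
      ∀ x, χ x = 1 ↔ x ∈ residues p 4 := by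
  have hI : IsPrimitiveRoot Complex.I 4 := Complex.isPrimitiveRoot_I
  obtain ⟨χ, hχ⟩ := MulChar.exists_mulChar_orderOf (ZMod p) (n := 4)
    (by rw [ZMod.card, hp]; omega) hI
  have h4 : χ ^ 4 = 1 := hχ ▸ pow_orderOf_eq_one χ
  have h2 : χ ^ 2 ≠ 1 := fun h => by
    have := orderOf_dvd_of_pow_eq_one h
    rw [hχ] at this
    omega
  obtain ⟨g, hg⟩ := IsCyclic.exists_generator (α := (ZMod p)ˣ)
  have hcard : orderOf g = 8 * q + 4 := by
    rw [orderOf_eq_card_of_forall_mem_zpowers hg, Nat.card_eq_fintype_card, ZMod.card_units, hp]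
    omega
  have hg4 : χ g ^ 4 = 1 := by
    rw [← MulChar.pow_apply_coe, h4, MulChar.one_apply_coe]
  have hg2 : χ g ^ 2 ≠ 1 := fun h => h2 <| (MulChar.eq_iff hg _ _).2 <| by
    rw [MulChar.pow_apply_coe, h, MulChar.one_apply_coe]
  have hg2' : χ g ^ 2 = -1 := by
    have : (χ g ^ 2 - 1) * (χ g ^ 2 + 1) = 0 := by linear_combination hg4
    rcases mul_eq_zero.1 this with h | h
    · exact absurd (sub_eq_zero.1 h) hg2
    · exact eq_neg_of_add_eq_zero_left h
  have hord : orderOf (χ g) = 4 := by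
    rw [show 4 = 2 ^ (1 + 1) by norm_num]
    exact orderOf_eq_prime_pow (by simpa using hg2) (by simpa using hg4)
  refine ⟨χ, h4, h2, ?_, fun x => ⟨fun hx => ?_, ?_⟩⟩
  -- -1 = g^((p-1)/2), and the exponent 4q + 2 is 2 mod 4, so χ(-1) = χ(g)² = -1.
  · have hm : g ^ (4 * q + 2) = -1 := by
      have hsq : (g ^ (4 * q + 2)) ^ 2 = 1 := by
        rw [← pow_mul, show (4 * q + 2) * 2 = orderOf g by rw [hcard]; ring, pow_orderOf_eq_one]
      have hne : g ^ (4 * q + 2) ≠ 1 := fun h => by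
        have := Nat.le_of_dvd (by omega) (orderOf_dvd_of_pow_eq_one h)
        omega
      have hsq' : ((g ^ (4 * q + 2) : (ZMod p)ˣ) : ZMod p) ^ 2 = 1 := by
        rw [← Units.val_pow_eq_pow_val, hsq, Units.val_one]
      rcases sq_eq_sq_iff_eq_or_eq_neg.1 (hsq'.trans (one_pow 2).symm) with h | h
      · exact absurd (Units.ext h) hne
      · exact Units.ext h
    have : χ (-1) = χ ((g ^ (4 * q + 2) : (ZMod p)ˣ) : ZMod p) := by rw [hm]; simp
    rw [this, Units.val_pow_eq_pow_val, map_pow, pow_add, pow_mul, hg4, one_pow, one_mul, hg2']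
  · have hx0 : IsUnit x := by
      by_contra h
      rw [χ.map_nonunit h] at hx
      exact zero_ne_one hx
    obtain ⟨u, rfl⟩ := hx0
    obtain ⟨k, rfl⟩ := (mem_powers_iff_mem_zpowers.2 (hg u))
    simp only [Units.val_pow_eq_pow_val, map_pow] at hx
    obtain ⟨j, rfl⟩ := hord ▸ orderOf_dvd_of_pow_eq_one hx
    exact ⟨g ^ j, by rw [← pow_mul, mul_comm]⟩
  · rintro ⟨z, rfl⟩
    rw [Units.val_pow_eq_pow_val, map_pow, ← MulChar.pow_apply_coe, h4, MulChar.one_apply_coe]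

lemma eq_of_pow_four_eq_one {z : ℂ} (hz : z ^ 4 = 1) :
    z = 1 ∨ z = -1 ∨ z = Complex.I ∨ z = -Complex.I := by
  have h : (z - 1) * ((z + 1) * ((z - Complex.I) * (z + Complex.I))) = 0 := by
    linear_combination hz - (z ^ 2 - 1) * Complex.I_sq
  rcases mul_eq_zero.1 h with h | h
  · exact Or.inl (sub_eq_zero.1 h)
  rcases mul_eq_zero.1 h with h | h
  · exact Or.inr (Or.inl (eq_neg_of_add_eq_zero_left h))
  rcases mul_eq_zero.1 h with h | h
  · exact Or.inr (Or.inr (Or.inl (sub_eq_zero.1 h)))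
  · exact Or.inr (Or.inr (Or.inr (eq_neg_of_add_eq_zero_left h)))

lemma MulChar.apply_pow_four {p : ℕ} [Fact p.Prime] {χ : MulChar (ZMod p) ℂ} (h4 : χ ^ 4 = 1)
    {x : ZMod p} (hx : x ≠ 0) : χ x ^ 4 = 1 := by
  rw [← χ.pow_apply' (by norm_num), h4, MulChar.one_apply hx.isUnit]

/-- The Jacobi sum of a quartic character and its square is congruent to `-p` modulo
`2 (1 - i)`. -/
lemma exists_jacobiSum_quartic {p : ℕ} [Fact p.Prime] {χ : MulChar (ZMod p) ℂ} (h4 : χ ^ 4 = 1)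
    (h2 : χ ^ 2 ≠ 1) :
    ∃ a b : ℤ, jacobiSum χ (χ ^ 2) + p = 2 * (1 - Complex.I) * (a + b * Complex.I) := by
  have h1 : χ ≠ 1 := fun h => h2 (by rw [h, one_pow])
  -- For x ≠ 0, 1 the first factor is a fourth root of unity minus 1, divisible by 1 - i, and the
  -- second is 0 or -2. Expanding the sum over x leaves J + p, because the sums of χ and χ² vanish.
  have hterm : ∀ x : ZMod p, ∃ a b : ℤ, (χ x - 1) * ((χ ^ 2) (1 - x) - 1) =
      2 * (1 - Complex.I) * (a + b * Complex.I) := by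
    intro x
    rcases eq_or_ne x 0 with rfl | hx
    · exact ⟨0, 0, by simp⟩
    rcases eq_or_ne x 1 with rfl | hx1
    · exact ⟨0, 0, by simp⟩
    have hx' : 1 - x ≠ 0 := sub_ne_zero.2 hx1.symm
    have hval : ∃ a b : ℤ, χ x - 1 = (1 - Complex.I) * (a + b * Complex.I) := by
      rcases eq_of_pow_four_eq_one (χ.apply_pow_four h4 hx) with h | h | h | h <;> rw [h]
      · exact ⟨0, 0, by simp⟩
      · exact ⟨-1, -1, by push_cast; linear_combination -Complex.I_sq⟩
      · exact ⟨-1, 0, by push_cast; ring⟩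
      · exact ⟨0, -1, by push_cast; linear_combination -Complex.I_sq⟩
    have hval2 : (χ ^ 2) (1 - x) = 1 ∨ (χ ^ 2) (1 - x) = -1 := by
      rw [← sq_eq_sq_iff_eq_or_eq_neg, one_pow, χ.pow_apply' two_ne_zero, ← pow_mul]
      exact χ.apply_pow_four h4 hx'
    obtain ⟨a, b, hab⟩ := hval
    rcases hval2 with h | h <;> rw [h, hab]
    · exact ⟨0, 0, by simp⟩
    · exact ⟨-a, -b, by push_cast; ring⟩
  choose a b hab using hterm
  refine ⟨∑ x, a x, ∑ x, b x, ?_⟩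
  have hsum : ∑ x : ZMod p, (χ x - 1) * ((χ ^ 2) (1 - x) - 1) = jacobiSum χ (χ ^ 2) + p := by
    have e : ∀ x : ZMod p, (χ x - 1) * ((χ ^ 2) (1 - x) - 1) =
        χ x * (χ ^ 2) (1 - x) - χ x - (χ ^ 2) (1 - x) + 1 := fun x => by ring
    simp_rw [e, Finset.sum_add_distrib, Finset.sum_sub_distrib]
    have h2' : ∑ x : ZMod p, (χ ^ 2) (1 - x) = 0 :=
      ((Equiv.subLeft (1 : ZMod p)).sum_comp (fun y => (χ ^ 2) y)).trans
        (MulChar.sum_eq_zero_of_ne_one h2)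
    rw [MulChar.sum_eq_zero_of_ne_one h1, h2', jacobiSum]
    simp [ZMod.card]
  rw [← hsum, Finset.sum_congr rfl fun x _ => hab x, ← Finset.mul_sum, Finset.sum_add_distrib,
    ← Finset.sum_mul]
  push_cast
  rfl

/-- The congruence gives J = 2(a+b) - p + 2(b-a)i. The real part is 1 mod 4 exactly when a + b is
odd; an even a + b would make |J|² ≡ 1 mod 8, against p ≡ 5. -/
lemma exists_jacobiSum_quartic_eq {p q : ℕ} [Fact p.Prime] (hp : p = 8 * q + 5)
    {χ : MulChar (ZMod p) ℂ} (h4 : χ ^ 4 = 1) (h2 : χ ^ 2 ≠ 1)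
    (hnorm : Complex.normSq (jacobiSum χ (χ ^ 2)) = p) :
    ∃ x y : ℤ, x % 4 = 1 ∧ (p : ℤ) = x ^ 2 + 4 * y ^ 2 ∧
      (jacobiSum χ (χ ^ 2)).re = x := by
  obtain ⟨a, b, h⟩ := exists_jacobiSum_quartic h4 h2
  have hre := congrArg Complex.re h
  have him := congrArg Complex.im h
  simp at hre him
  have hre' : (jacobiSum χ (χ ^ 2)).re = ((2 * (a + b) - p : ℤ) : ℝ) := by
    push_cast; linarith
  have him' : (jacobiSum χ (χ ^ 2)).im = ((2 * (b - a) : ℤ) : ℝ) := by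
    push_cast; linarith
  have hN : (p : ℤ) = (2 * (a + b) - p) ^ 2 + 4 * (b - a) ^ 2 := by
    rw [Complex.normSq_apply, hre', him'] at hnorm
    have : (2 * (a + b) - p) * (2 * (a + b) - p) + (2 * (b - a)) * (2 * (b - a)) = (p : ℤ) := by
      exact_mod_cast hnorm
    linarith
  refine ⟨2 * (a + b) - p, b - a, ?_, hN, hre'⟩
  have hp' : (p : ℤ) = 8 * q + 5 := by exact_mod_cast hp
  rcases Int.even_or_odd' (a + b) with ⟨k, hk | hk⟩
  · exfalso
    have hd : b - a = 2 * (b - k) := by linarith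
    rw [hd, hk, hp'] at hN
    -- `hN` reads 8n + 4 = 0, the 4 coming from p² - p = 8(8q² + 9q + 2) + 4.
    obtain ⟨n, hn⟩ : ∃ n : ℤ, n = 2 * k ^ 2 - k * (8 * q + 5) + 8 * q ^ 2 + 9 * q + 2 +
      2 * (b - k) ^ 2 := ⟨_, rfl⟩
    have : 8 * n + 4 = 0 := by rw [hn]; linear_combination -hN
    omega
  · omega

lemma inv_eq_pow_three_of_pow_four_eq_one {G : Type*} [Group G] {χ : G} (h4 : χ ^ 4 = 1) :
    χ⁻¹ = χ ^ 3 :=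
  inv_eq_of_mul_eq_one_right (by rw [← pow_succ', h4])

lemma ne_one_of_sq_ne_one {M : Type*} [Monoid M] {χ : M} (h2 : χ ^ 2 ≠ 1) : χ ≠ 1 :=
  fun h => h2 (by rw [h, one_pow])

/-! ### Gauss sums and quartic periods -/

section
variable {p : ℕ} [Fact p.Prime] {χ : MulChar (ZMod p) ℂ}

open Classical in
/-- The indicator function of the fourth powers in terms of a quartic character. -/
lemma four_mul_indicator_residues (h4 : χ ^ 4 = 1)
    (hker : ∀ x, χ x = 1 ↔ x ∈ residues p 4) (x : ZMod p) :
    4 * (if x ∈ residues p 4 then (1 : ℂ) else 0) =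
      (1 : MulChar (ZMod p) ℂ) x + χ x + (χ ^ 2) x + χ⁻¹ x := by
  rw [inv_eq_pow_three_of_pow_four_eq_one h4, χ.pow_apply' two_ne_zero, χ.pow_apply' three_ne_zero]
  rcases eq_or_ne x 0 with rfl | hx
  · have : (0 : ZMod p) ∉ residues p 4 := fun h => by
      have := (hker 0).2 h
      rw [χ.map_zero] at this
      exact zero_ne_one this
    rw [if_neg this]
    simp [MulChar.map_zero]
  rw [MulChar.one_apply hx.isUnit]
  by_cases h : χ x = 1
  · rw [if_pos ((hker x).1 h), h]; norm_num
  · rw [if_neg (mt (hker x).2 h)]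
    have h' : (χ x - 1) * (1 + χ x + χ x ^ 2 + χ x ^ 3) = 0 := by
      linear_combination χ.apply_pow_four h4 hx
    rcases mul_eq_zero.1 h' with h' | h'
    · exact absurd (sub_eq_zero.1 h') h
    · rw [h', mul_zero]

open Classical in
lemma four_mul_sum_residues (h4 : χ ^ 4 = 1) (hker : ∀ x, χ x = 1 ↔ x ∈ residues p 4)
    {ψ : AddChar (ZMod p) ℂ} (hψ : ψ ≠ 1) :
    4 * ∑ x, (if x ∈ residues p 4 then ψ x else 0) =
      -1 + gaussSum χ ψ + gaussSum (χ ^ 2) ψ + gaussSum χ⁻¹ ψ := by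
  rw [← gaussSum_one_left hψ, gaussSum, gaussSum, gaussSum, gaussSum, Finset.mul_sum,
    ← Finset.sum_add_distrib, ← Finset.sum_add_distrib, ← Finset.sum_add_distrib]
  refine Finset.sum_congr rfl fun x _ => ?_
  rw [← add_mul, ← add_mul, ← add_mul, ← four_mul_indicator_residues h4 hker x]
  split_ifs <;> simp

open Classical in
lemma four_mul_card_residues (h4 : χ ^ 4 = 1) (h2 : χ ^ 2 ≠ 1)
    (hker : ∀ x, χ x = 1 ↔ x ∈ residues p 4) :
    4 * ∑ x, (if x ∈ residues p 4 then (1 : ℂ) else 0) = p - 1 := by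
  have h1 := ne_one_of_sq_ne_one h2
  rw [Finset.mul_sum, Finset.sum_congr rfl fun x _ => four_mul_indicator_residues h4 hker x,
    Finset.sum_add_distrib, Finset.sum_add_distrib, Finset.sum_add_distrib,
    MulChar.sum_eq_zero_of_ne_one h1, MulChar.sum_eq_zero_of_ne_one h2,
    MulChar.sum_eq_zero_of_ne_one (inv_ne_one.2 h1), MulChar.sum_one_eq_card_units,
    ZMod.card_units, Nat.cast_sub (Fact.out : p.Prime).one_lt.le]
  simp

/-- Gauss sums of a nontrivial character have absolute value `√p`. -/
lemma gaussSum_mul_star {φ : MulChar (ZMod p) ℂ} (hφ : φ ≠ 1) {ψ : AddChar (ZMod p) ℂ}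
    (hψ : ψ ≠ 1) : gaussSum φ ψ * star (gaussSum φ ψ) = p := by
  rw [star_gaussSum_eq, gaussSum_mul_gaussSum_eq_card hφ (AddChar.IsPrimitive.of_ne_one hψ),
    ZMod.card]

/-- Conjugation inverts both characters; replacing x by -x restores ψ at the cost of χ(-1). For χ²
that cost is 1, so its Gauss sum is real. -/
lemma star_gaussSum_of_odd (hm : χ (-1) = -1) (ψ : AddChar (ZMod p) ℂ) :
    star (gaussSum χ ψ) = - gaussSum χ⁻¹ ψ := by
  have h := mul_gaussSum_inv_eq_gaussSum χ⁻¹ ψ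
  rw [MulChar.inv_apply_eq_inv', hm] at h
  rw [star_gaussSum_eq, ← h]
  norm_num

lemma star_gaussSum_sq (h4 : χ ^ 4 = 1) (hm : χ (-1) = -1) (ψ : AddChar (ZMod p) ℂ) :
    star (gaussSum (χ ^ 2) ψ) = gaussSum (χ ^ 2) ψ := by
  have hinv : (χ ^ 2)⁻¹ = χ ^ 2 := inv_eq_of_mul_eq_one_right (by rw [← pow_add, h4])
  have h := mul_gaussSum_inv_eq_gaussSum (χ ^ 2) ψ
  rw [χ.pow_apply' two_ne_zero, hm] at h
  rw [star_gaussSum_eq, hinv, ← h]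
  norm_num

/-- The square of a quartic Gauss sum in terms of a Jacobi sum. -/
lemma gaussSum_quartic_sq (h4 : χ ^ 4 = 1) (h2 : χ ^ 2 ≠ 1) (hm : χ (-1) = -1)
    {ψ : AddChar (ZMod p) ℂ} (hψ : ψ ≠ 1) :
    gaussSum χ ψ ^ 2 = - jacobiSum χ (χ ^ 2) * gaussSum (χ ^ 2) ψ := by
  have h1 := ne_one_of_sq_ne_one h2
  have hp0 : (p : ℂ) ≠ 0 := by exact_mod_cast (Fact.out : p.Prime).ne_zero
  have e : χ * χ ^ 2 = χ⁻¹ := by rw [inv_eq_pow_three_of_pow_four_eq_one h4, ← pow_succ']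
  have hJ := jacobiSum_mul_nontrivial (χ := χ) (φ := χ ^ 2) (by rw [e]; exact inv_ne_one.2 h1) ψ
  rw [e] at hJ
  have hs := star_gaussSum_of_odd hm ψ
  have hw := gaussSum_mul_star h1 hψ
  have hs2 := gaussSum_mul_star h2 hψ
  rw [star_gaussSum_sq h4 hm] at hs2
  rw [hs] at hw
  -- Multiply G(χ⁻¹) J = G(χ) G(χ²) by G(χ) G(χ²), then use G(χ²)² = p = -G(χ) G(χ⁻¹).
  apply mul_left_cancel₀ hp0
  linear_combination (-gaussSum (χ ^ 2) ψ * gaussSum χ ψ) * hJ - gaussSum χ ψ ^ 2 * hs2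
    - jacobiSum χ (χ ^ 2) * gaussSum (χ ^ 2) ψ * hw

/-- Compare absolute values in `gaussSum_quartic_sq` for any nontrivial ψ: all Gauss sums there have
modulus √p. -/
lemma normSq_jacobiSum_quartic (h4 : χ ^ 4 = 1) (h2 : χ ^ 2 ≠ 1) (hm : χ (-1) = -1) :
    Complex.normSq (jacobiSum χ (χ ^ 2)) = p := by
  have h1 := ne_one_of_sq_ne_one h2
  have hp0 : (p : ℂ) ≠ 0 := by exact_mod_cast (Fact.out : p.Prime).ne_zero
  obtain ⟨ψ, hψ⟩ : ∃ ψ : AddChar (ZMod p) ℂ, ψ ≠ 1 :=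
    ⟨ZMod.stdAddChar, by simpa using (ZMod.isPrimitive_stdAddChar p) one_ne_zero⟩
  have h := gaussSum_quartic_sq h4 h2 hm hψ
  have hstar := congrArg star h
  rw [star_mul', star_neg, star_pow] at hstar
  have hw := gaussSum_mul_star h1 hψ
  have hs := gaussSum_mul_star h2 hψ
  have key : (p : ℂ) * (jacobiSum χ (χ ^ 2) * star (jacobiSum χ (χ ^ 2))) = p * p := by
    calc _ = (-jacobiSum χ (χ ^ 2) * gaussSum (χ ^ 2) ψ) *
          (-star (jacobiSum χ (χ ^ 2)) * star (gaussSum (χ ^ 2) ψ)) := by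
            rw [← hs]; ring
      _ = (gaussSum χ ψ * star (gaussSum χ ψ)) ^ 2 := by rw [← h, ← hstar]; ring
      _ = _ := by rw [hw]; ring
  have := mul_left_cancel₀ hp0 key
  rw [← starRingEnd_apply, Complex.mul_conj] at this
  exact_mod_cast this

end

open Classical in
/-- The quartic Gauss periods for a prime `p = 8 q + 5`, where `p = x² + 4 y²` with
`x ≡ 1 mod 4`. -/
theorem exists_quartic_periods {p q : ℕ} [Fact p.Prime] (hp : p = 8 * q + 5) :
    ∃ (x y : ℤ) (ε : ZMod p → ℝ), x % 4 = 1 ∧ (p : ℤ) = x ^ 2 + 4 * y ^ 2 ∧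
      (∀ d, d ≠ 0 → ε d = 1 ∨ ε d = -1) ∧ ε 0 = 0 ∧ ∑ d, ε d = 0 ∧
      4 * ∑ x, (if x ∈ residues p 4 then (1 : ℂ) else 0) = p - 1 ∧
      ∀ d, d ≠ 0 → ∃ v : ℝ, v ^ 2 = 2 * p + 2 * (ε d * √p) * x ∧
        4 * ∑ r, (if r ∈ residues p 4 then (ZMod.stdAddChar (r * d) : ℂ) else 0) =
          ((-1 + ε d * √p : ℝ) : ℂ) + v * Complex.I := by
  obtain ⟨χ, h4, h2, hm, hker⟩ := exists_quartic_mulChar hp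
  have h1 := ne_one_of_sq_ne_one h2
  have hp0 : (0 : ℝ) < p := by exact_mod_cast (Fact.out : p.Prime).pos
  have hs0 : 0 < √(p : ℝ) := Real.sqrt_pos.2 hp0
  obtain ⟨x, y, hx, hxy, hJ⟩ :=
    exists_jacobiSum_quartic_eq hp h4 h2 (normSq_jacobiSum_quartic h4 h2 hm)
  set ψ : ZMod p → AddChar (ZMod p) ℂ := fun d => ZMod.stdAddChar.mulShift d with hψdef
  have hψ : ∀ d, d ≠ 0 → ψ d ≠ 1 := fun d hd => ZMod.isPrimitive_stdAddChar p hd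
  have hre : ∀ d, (((gaussSum (χ ^ 2) (ψ d)).re : ℝ) : ℂ) = gaussSum (χ ^ 2) (ψ d) := fun d =>
    Complex.conj_eq_iff_re.1 (star_gaussSum_sq h4 hm (ψ d))
  have hsq : ∀ d, d ≠ 0 → (gaussSum (χ ^ 2) (ψ d)).re ^ 2 = p := fun d hd => by
    have := gaussSum_mul_star h2 (hψ d hd)
    rw [star_gaussSum_sq h4 hm, ← hre d] at this
    rw [sq]
    exact_mod_cast this
  have hmul : ∀ d, (gaussSum (χ ^ 2) (ψ d)).re / √p * √p = (gaussSum (χ ^ 2) (ψ d)).re :=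
    fun d => div_mul_cancel₀ _ hs0.ne'
  have hzero : gaussSum (χ ^ 2) (ψ 0) = 0 := by
    simp only [hψdef, AddChar.mulShift_zero]
    exact gaussSum_one_right h2
  -- ε is the normalised quadratic Gauss sum at the shift d. Its absolute sign is never needed, only
  -- that it is ±1 off zero and has mean zero.
  refine ⟨x, y, fun d => (gaussSum (χ ^ 2) (ψ d)).re / √p, hx, hxy, fun d hd => ?_, ?_, ?_,
    four_mul_card_residues h4 h2 hker, fun d hd => ?_⟩
  · rw [← sq_eq_sq_iff_eq_or_eq_neg, one_pow, div_pow, hsq d hd, Real.sq_sqrt hp0.le,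
      div_self hp0.ne']
  · simp [hzero]
  · rw [← Finset.sum_div, ← Complex.re_sum]
    have : ∑ d, gaussSum (χ ^ 2) (ψ d) = 0 := by
      have e : ∀ d, gaussSum (χ ^ 2) (ψ d) = (χ ^ 2)⁻¹ d * gaussSum (χ ^ 2) (ψ 1) := by
        intro d
        rcases eq_or_ne d 0 with rfl | hd
        · rw [hzero, MulChar.map_zero, zero_mul]
        · have := gaussSum_mulShift_eq (χ ^ 2) (ψ 1) (Units.mk0 d hd)
          simpa [hψdef] using this
      rw [Finset.sum_congr rfl fun d _ => e d, ← Finset.sum_mul,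
        MulChar.sum_eq_zero_of_ne_one (inv_ne_one.2 h2), zero_mul]
    simp [this]
  · simp only [hmul]
    set w := gaussSum χ (ψ d)
    -- w - conj w = 2i Im w, and 4(Im w)² = 2(|w|² - Re w²).
    refine ⟨2 * w.im, ?_, ?_⟩
    · have hw := gaussSum_mul_star h1 (hψ d hd)
      rw [← starRingEnd_apply, Complex.mul_conj, Complex.normSq_apply] at hw
      have hw' : w.re * w.re + w.im * w.im = p := by exact_mod_cast hw
      have hq := congrArg Complex.re (gaussSum_quartic_sq h4 h2 hm (hψ d hd))
      rw [← hre d, Complex.re_mul_ofReal, Complex.neg_re, hJ, sq, Complex.mul_re] at hq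
      linear_combination 2 * hw' - 2 * hq
    · have h := four_mul_sum_residues h4 hker (hψ d hd)
      have hodd := star_gaussSum_of_odd hm (ψ d)
      have hsum : ∀ r, ψ d r = ZMod.stdAddChar (r * d) := fun r => by
        simp [hψdef, mul_comm]
      simp only [hsum] at h
      rw [h, ← neg_eq_iff_eq_neg.2 hodd, ← hre d]
      apply Complex.ext <;> simp [w] <;> ring

/-! ### Harmonic frames: tightness, angles, multiplicities -/

section
variable {n m : ℕ} [NeZero n] {S : Set (ZMod n)}

open Classical in
lemma sum_comp_enumeration (g : Fin m ≃ S) (F : ZMod n → ℂ) :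
    ∑ j, F (g j) = ∑ x, if x ∈ S then F x else 0 := by
  rw [g.sum_comp (fun s : S => F s), ← Finset.sum_filter]
  exact (Finset.sum_subtype _ (fun _ => by rw [Finset.mem_filter_univ]) F).symm

lemma conj_stdAddChar (x : ZMod n) :
    (starRingEnd ℂ) (ZMod.stdAddChar x) = ZMod.stdAddChar (-x) :=
  (AddChar.map_neg_eq_conj _ _).symm

lemma one_div_sqrt_natCast_sq (m : ℕ) :
    (1 / (Real.sqrt m : ℂ)) * (1 / (Real.sqrt m : ℂ)) = 1 / m := by
  rw [div_mul_div_comm, one_mul, ← Complex.ofReal_mul, Real.mul_self_sqrt (Nat.cast_nonneg m)]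
  simp

lemma inner_harmonicFrame (g : Fin m ≃ S) (x y : ZMod n) :
    inner ℂ (harmonicFrame g x) (harmonicFrame g y) =
      1 / m * ∑ j, ZMod.stdAddChar ((g j : ZMod n) * (y - x)) := by
  rw [Finset.mul_sum, PiLp.inner_apply]
  refine Finset.sum_congr rfl fun j _ => ?_
  rw [RCLike.inner_apply, ← one_div_sqrt_natCast_sq]
  simp only [harmonicFrame, map_mul, conj_stdAddChar]
  rw [mul_sub, sub_eq_add_neg, AddChar.map_add_eq_mul, ← Complex.ofReal_one,
    ← Complex.ofReal_div, Complex.conj_ofReal]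
  ring

lemma isUnitNorm_harmonicFrame (hm : m ≠ 0) (g : Fin m ≃ S) : IsUnitNorm (harmonicFrame g) := by
  intro x
  have h := inner_self_eq_norm_sq_to_K (𝕜 := ℂ) (harmonicFrame g x)
  rw [inner_harmonicFrame] at h
  have hm' : (m : ℂ) ≠ 0 := by exact_mod_cast hm
  have h' : ‖harmonicFrame g x‖ ^ 2 = 1 := by
    have : ((‖harmonicFrame g x‖ ^ 2 : ℝ) : ℂ) = 1 := by
      push_cast
      rw [← Complex.coe_algebraMap, ← h]
      simp [hm']
    exact_mod_cast this
  exact (pow_eq_one_iff_of_nonneg (norm_nonneg _) two_ne_zero).1 h'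

/-- Orthogonality of characters: summing over x kills the (k, j) entry unless g k = g j, and each
diagonal entry is n · (1/m). -/
lemma isTight_harmonicFrame (hm : m ≠ 0) (g : Fin m ≃ S) : IsTight (harmonicFrame g) := by
  refine ⟨n / m, div_pos (by exact_mod_cast NeZero.pos n) (by exact_mod_cast hm.bot_lt), ?_⟩
  ext z k
  have e : ∀ x : ZMod n, ((InnerProductSpace.rankOne ℂ (harmonicFrame g x)
      (harmonicFrame g x)) z) k =
      ∑ j, 1 / m * z j * ZMod.stdAddChar (x * ((g k : ZMod n) - (g j : ZMod n))) := by
    intro x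
    rw [InnerProductSpace.rankOne_apply, PiLp.inner_apply, PiLp.smul_apply, smul_eq_mul,
      Finset.sum_mul]
    refine Finset.sum_congr rfl fun j _ => ?_
    rw [RCLike.inner_apply, ← one_div_sqrt_natCast_sq]
    simp only [harmonicFrame, map_mul, conj_stdAddChar]
    rw [mul_sub, sub_eq_add_neg, AddChar.map_add_eq_mul, ← Complex.ofReal_one,
      ← Complex.ofReal_div, Complex.conj_ofReal, mul_comm x, mul_comm x]
    ring
  rw [sum_apply, WithLp.ofLp_sum, Finset.sum_apply,
    Finset.sum_congr rfl fun x _ => e x, Finset.sum_comm]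
  simp_rw [← Finset.mul_sum, AddChar.sum_mulShift _ (ZMod.isPrimitive_stdAddChar n), sub_eq_zero,
    Subtype.coe_inj, g.injective.eq_iff]
  simp [ZMod.card]
  ring

end

lemma IsTight.isFrame {ι : Type*} [Fintype ι] {m : ℕ} {f : ι → EuclideanSpace ℂ (Fin m)}
    (hf : IsTight f) : IsFrame f := by
  obtain ⟨a, ha, h⟩ := hf
  refine eq_top_iff.2 fun z _ => ?_
  have hz := congrArg (fun T => (a : ℂ)⁻¹ • T z) h
  have ha' : (a : ℂ) ≠ 0 := by exact_mod_cast ha.ne'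
  simp only [sum_apply, InnerProductSpace.rankOne_apply,
    smul_apply, ContinuousLinearMap.id_apply, inv_smul_smul₀ ha'] at hz
  rw [← hz]
  exact Submodule.smul_mem _ _ <| Submodule.sum_mem _ fun j _ =>
    Submodule.smul_mem _ _ (Submodule.subset_span ⟨j, rfl⟩)

lemma isAngularTightFrame_harmonicFrame {n m d : ℕ} [NeZero n] {S : Set (ZMod n)} (hm : m ≠ 0)
    (g : Fin m ≃ S) (h : IsAngular d (harmonicFrame g)) :
    IsAngularTightFrame d (harmonicFrame g) :=
  ⟨(isTight_harmonicFrame hm g).isFrame, isUnitNorm_harmonicFrame hm g,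
    isTight_harmonicFrame hm g, h⟩

lemma isETF_harmonicFrame {n m : ℕ} [NeZero n] {S : Set (ZMod n)} (hn : 1 < n) (hm : m ≠ 0)
    (g : Fin m ≃ S) {α : ℝ}
    (h : ∀ x y, x ≠ y → ‖inner ℂ (harmonicFrame g x) (harmonicFrame g y)‖ = α) :
    IsETF (harmonicFrame g) := by
  refine isAngularTightFrame_harmonicFrame hm g ?_
  have : frameAngles (harmonicFrame g) = {α} := by
    have : Fact (1 < n) := ⟨hn⟩
    ext r
    refine ⟨?_, ?_⟩
    · rintro ⟨x, y, hxy, rfl⟩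
      exact h x y hxy
    · rintro rfl
      exact ⟨0, 1, zero_ne_one, h 0 1 zero_ne_one⟩
  rw [IsAngular, this, Set.encard_singleton, Nat.cast_one]

/-- A function on `ZMod n` with values `±1` away from zero, with `ε 0 = 0` and with mean zero
takes both values `±1` equally often. -/
lemma encard_sign_fiber {n : ℕ} [NeZero n] {ε : ZMod n → ℝ}
    (hε : ∀ d, d ≠ 0 → ε d = 1 ∨ ε d = -1) (h0 : ε 0 = 0) (hsum : ∑ d, ε d = 0) {s : ℝ}
    (hs : s = 1 ∨ s = -1) : {d | ε d = s}.encard = ((n - 1) / 2 : ℕ) := by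
  classical
  have e : ∀ d, 2 * (if ε d = s then (1 : ℝ) else 0) = 1 - (if d = 0 then 1 else 0) + s * ε d := by
    intro d
    rcases eq_or_ne d 0 with rfl | hd
    · have : (0 : ℝ) ≠ s := by rcases hs with rfl | rfl <;> norm_num
      simp [h0, this]
    · rcases hε d hd with h | h <;> rcases hs with rfl | rfl <;> norm_num [h, hd]
  have hcard : 2 * ((Finset.univ.filter fun d => ε d = s).card : ℝ) = n - 1 := by
    rw [Finset.card_filter, Nat.cast_sum, Finset.mul_sum]
    push_cast
    rw [Finset.sum_congr rfl fun d _ => e d, Finset.sum_add_distrib, Finset.sum_sub_distrib,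
      ← Finset.mul_sum, hsum]
    simp [ZMod.card]
  -- This forces n to be odd, so the truncated quotient (n - 1) / 2 is exact.
  have hcard' : 2 * (Finset.univ.filter fun d => ε d = s).card + 1 = n := by
    have : 2 * ((Finset.univ.filter fun d => ε d = s).card : ℝ) + 1 = n := by linarith
    exact_mod_cast this
  rw [← Finset.coe_filter_univ, Set.encard_coe_eq_coe_finsetCard]
  congr 1
  omega

lemma biangular_harmonicFrame {n m : ℕ} [NeZero n] {S : Set (ZMod n)} (hn : 3 ≤ n) (hm : m ≠ 0)
    (g : Fin m ≃ S) {ε : ZMod n → ℝ} (hε : ∀ d, d ≠ 0 → ε d = 1 ∨ ε d = -1) (h0 : ε 0 = 0)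
    (hsum : ∑ d, ε d = 0) {α β : ℝ} (hαβ : α ≠ β)
    (h1 : ∀ x y, ε (y - x) = 1 → ‖inner ℂ (harmonicFrame g x) (harmonicFrame g y)‖ = α)
    (h2 : ∀ x y, ε (y - x) = -1 → ‖inner ℂ (harmonicFrame g x) (harmonicFrame g y)‖ = β) :
    IsBTF (harmonicFrame g) ∧ frameAngles (harmonicFrame g) = {α, β} ∧
      HasMultiplicity (harmonicFrame g) α ((n - 1) / 2) ∧
      HasMultiplicity (harmonicFrame g) β ((n - 1) / 2) := by
  have hne : ∀ {s : ℝ} {x y : ZMod n}, (s = 1 ∨ s = -1) → ε (y - x) = s → y ≠ x := by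
    rintro s x y hs h rfl
    rw [sub_self, h0] at h
    rcases hs with rfl | rfl <;> norm_num at h
  have hmult : ∀ {s γ : ℝ}, (s = 1 ∨ s = -1) →
      (∀ x y, y ≠ x → (‖inner ℂ (harmonicFrame g x) (harmonicFrame g y)‖ = γ ↔ ε (y - x) = s)) →
      HasMultiplicity (harmonicFrame g) γ ((n - 1) / 2) := by
    intro s γ hs h x
    rw [← encard_sign_fiber hε h0 hsum hs,
      ← (Equiv.subRight x).injective.encard_image {y | y ≠ x ∧ _}]
    congr 1
    ext d
    simp only [Set.mem_image, Set.mem_ofPred_eq, Equiv.subRight_apply]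
    constructor
    · rintro ⟨y, ⟨hy, hy'⟩, rfl⟩
      exact (h x y hy).1 hy'
    · intro hd
      have hd' : ε (d + x - x) = s := by rwa [add_sub_cancel_right]
      exact ⟨d + x, ⟨hne hs hd', (h x _ (hne hs hd')).2 hd'⟩, add_sub_cancel_right d x⟩
  have hangles : frameAngles (harmonicFrame g) = {α, β} := by
    -- Both angles really occur: n ≥ 3 makes (n - 1) / 2 positive, so neither sign fibre is empty.
    have hex : ∀ {s : ℝ}, (s = 1 ∨ s = -1) → ∃ d, ε d = s := fun {s} hs => by
      have h := encard_sign_fiber hε h0 hsum hs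
      refine Set.nonempty_iff_ne_empty.2 fun he => ?_
      change {d | ε d = s} = ∅ at he
      rw [he, Set.encard_empty] at h
      have : (n - 1) / 2 = 0 := by exact_mod_cast h.symm
      omega
    ext r
    constructor
    · rintro ⟨x, y, hxy, rfl⟩
      rcases hε (y - x) (sub_ne_zero.2 hxy.symm) with h | h
      · exact Or.inl (h1 x y h)
      · exact Or.inr (h2 x y h)
    · rintro (rfl | rfl)
      · obtain ⟨d, hd⟩ := hex (Or.inl rfl)
        have hd' : ε (d - 0) = 1 := by rwa [sub_zero]
        exact ⟨0, d, (hne (Or.inl rfl) hd').symm, h1 0 d hd'⟩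
      · obtain ⟨d, hd⟩ := hex (Or.inr rfl)
        have hd' : ε (d - 0) = -1 := by rwa [sub_zero]
        exact ⟨0, d, (hne (Or.inr rfl) hd').symm, h2 0 d hd'⟩
  refine ⟨isAngularTightFrame_harmonicFrame hm g ?_, hangles, hmult (Or.inl rfl) fun x y hxy =>
    ⟨fun h => ?_, h1 x y⟩, hmult (Or.inr rfl) fun x y hxy => ⟨fun h => ?_, h2 x y⟩⟩
  · rw [IsAngular, hangles, Set.encard_pair hαβ, Nat.cast_ofNat]
  · exact (hε _ (sub_ne_zero.2 hxy)).resolve_right fun h' => hαβ (h.symm.trans (h2 x y h'))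
  · exact (hε _ (sub_ne_zero.2 hxy)).resolve_left fun h' => hαβ ((h1 x y h').symm.trans h)

/-! ### Frames generated by the fourth powers, with or without zero -/

lemma zero_notMem_residues (p s : ℕ) [Fact p.Prime] : (0 : ZMod p) ∉ residues p s := by
  rintro ⟨z, hz⟩
  exact (z ^ s).ne_zero hz.symm

open Classical in
lemma sum_enumeration_residues_union_zero {p s m : ℕ} [Fact p.Prime]
    (g : Fin m ≃ (residues p s ∪ {0} : Set (ZMod p))) (F : ZMod p → ℂ) :
    ∑ j, F (g j) = ∑ x, (if x ∈ residues p s then F x else 0) + F 0 := by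
  rw [sum_comp_enumeration, show F 0 = ∑ x, if x = 0 then F x else 0 by simp,
    ← Finset.sum_add_distrib]
  refine Finset.sum_congr rfl fun x _ => ?_
  rcases eq_or_ne x 0 with rfl | hx
  · simp [zero_notMem_residues]
  · simp [hx]

open Classical in
/-- The inner products of the harmonic frames generated by the fourth powers (`c = 0`) and by the
fourth powers together with zero (`c = 4`). -/
lemma exists_norm_inner_harmonicFrame {p q : ℕ} [Fact p.Prime] (hp : p = 8 * q + 5) :
    ∃ (x y : ℤ) (ε : ZMod p → ℝ), x % 4 = 1 ∧ (p : ℤ) = x ^ 2 + 4 * y ^ 2 ∧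
      (∀ d, d ≠ 0 → ε d = 1 ∨ ε d = -1) ∧ ε 0 = 0 ∧ ∑ d, ε d = 0 ∧
      ∀ (c : ℕ) (S : Set (ZMod p)) (m : ℕ) (g : Fin m ≃ S),
        (∀ F : ZMod p → ℂ, 4 * ∑ j, F (g j) =
          4 * ∑ r, (if r ∈ residues p 4 then F r else 0) + c * F 0) →
        m ≠ 0 ∧ ∀ a b, a ≠ b → ‖inner ℂ (harmonicFrame g a) (harmonicFrame g b)‖ =
          1 / ((p : ℝ) - 1 + c) *
            √(3 * p + (c - 1) ^ 2 + ε (b - a) * (2 * (x + c - 1) * √p)) := by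
  obtain ⟨x, y, ε, hx, hxy, hε, h0, hsum, hcard, hper⟩ := exists_quartic_periods hp
  refine ⟨x, y, ε, hx, hxy, hε, h0, hsum, fun c S m g hF => ?_⟩
  -- Taking F = 1 in `hF` counts the generating set.
  have hm : 4 * (m : ℝ) = p - 1 + c := by
    have h := hF fun _ => 1
    rw [hcard] at h
    have h' : 4 * (m : ℂ) = p - 1 + c := by simpa using h
    exact_mod_cast h'
  have hp1 : (1 : ℝ) < p := by exact_mod_cast (Fact.out : p.Prime).one_lt
  have hm0 : (0 : ℝ) < m := by
    have := Nat.cast_nonneg (α := ℝ) c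
    linarith
  refine ⟨fun h => by simp [h] at hm0, fun a b hab => ?_⟩
  have hd : b - a ≠ 0 := sub_ne_zero.2 hab.symm
  obtain ⟨v, hv, hsumv⟩ := hper _ hd
  have h := hF fun r => ZMod.stdAddChar (r * (b - a))
  rw [hsumv, zero_mul, AddChar.map_zero_eq_one, mul_one] at h
  have h' : inner ℂ (harmonicFrame g a) (harmonicFrame g b) =
      ((1 / ((p : ℝ) - 1 + c) : ℝ) : ℂ) *
        (((-1 + ε (b - a) * √p + c : ℝ) : ℂ) + v * Complex.I) := by
    rw [inner_harmonicFrame, ← hm]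
    have hm0' : (m : ℂ) ≠ 0 := by exact_mod_cast hm0.ne'
    push_cast at h ⊢
    field_simp
    linear_combination h
  have hε2 : ε (b - a) ^ 2 = 1 := by rcases hε _ hd with h | h <;> rw [h] <;> norm_num
  have hsp : √(p : ℝ) ^ 2 = p := Real.sq_sqrt (by linarith)
  rw [h', norm_mul, Complex.norm_real, Real.norm_of_nonneg (by rw [← hm]; positivity),
    Complex.norm_add_mul_I]
  congr 2
  rw [hv]
  -- (c - 1 + ε√p)² + 2p + 2ε√p x, simplified with ε² = 1.
  linear_combination ε (b - a) ^ 2 * hsp + p * hε2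

/-- The sign of D depends on the shape of p, but replacing ε by -ε only exchanges the two fibres,
which have equal size. The angles differ since A + B > 0 and A + B > A - B, whatever the sign of A -
B. -/
lemma biangular_harmonicFrame_of_sqrt {n m : ℕ} [NeZero n] {S : Set (ZMod n)} (hn : 3 ≤ n)
    (hm : m ≠ 0) (g : Fin m ≃ S) {ε : ZMod n → ℝ} (hε : ∀ d, d ≠ 0 → ε d = 1 ∨ ε d = -1)
    (h0 : ε 0 = 0) (hsum : ∑ d, ε d = 0) {A B C D : ℝ} (hA : 0 < A) (hB : 0 < B) (hC : 0 < C)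
    (hD : D = B ∨ D = -B)
    (h : ∀ x y, x ≠ y → ‖inner ℂ (harmonicFrame g x) (harmonicFrame g y)‖ =
      1 / C * √(A + ε (y - x) * D)) :
    IsBTF (harmonicFrame g) ∧ frameAngles (harmonicFrame g) = {1 / C * √(A + B), 1 / C * √(A - B)} ∧
      HasMultiplicity (harmonicFrame g) (1 / C * √(A + B)) ((n - 1) / 2) ∧
      HasMultiplicity (harmonicFrame g) (1 / C * √(A - B)) ((n - 1) / 2) := by
  have hne : 1 / C * √(A + B) ≠ 1 / C * √(A - B) := fun e => by
    have h1 := mul_left_cancel₀ (one_div_pos.2 hC).ne' e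
    have h2 := (Real.sqrt_lt_sqrt_iff_of_pos (x := A - B) (y := A + B) (by linarith)).2
      (by linarith)
    exact h2.ne' h1
  obtain ⟨s, hs, rfl⟩ : ∃ s : ℝ, (s = 1 ∨ s = -1) ∧ D = s * B := by
    rcases hD with rfl | rfl
    · exact ⟨1, Or.inl rfl, (one_mul _).symm⟩
    · exact ⟨-1, Or.inr rfl, (neg_one_mul _).symm⟩
  have hxy : ∀ {t : ℝ} {x y : ZMod n}, t ≠ 0 → s * ε (y - x) = t → x ≠ y := by
    rintro t x y ht h' rfl
    rw [sub_self, h0, mul_zero] at h'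
    exact ht h'.symm
  refine biangular_harmonicFrame hn hm g (ε := fun d => s * ε d) (fun d hd => ?_) (by simp [h0])
    (by rw [← Finset.mul_sum, hsum, mul_zero]) hne (fun x y h' => ?_) (fun x y h' => ?_)
  · rcases hε d hd with h' | h' <;> rcases hs with rfl | rfl <;> norm_num [h']
  · rw [h x y (hxy one_ne_zero h'), ← mul_assoc, mul_comm (ε _), h', one_mul]
  · rw [h x y (hxy (by norm_num) h'), ← mul_assoc, mul_comm (ε _), h', neg_one_mul,
      ← sub_eq_add_neg]

/-- If `p = x² + 4 y²` with `x ≡ 1 mod 4`, then any `c ≡ 1 mod 4` with `p = c² + 4 a²` is `x`. -/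
lemma eq_of_prime_eq_sq_add_four_mul_sq {p : ℕ} (hp : p.Prime) {x y c a : ℤ} (hx : x % 4 = 1)
    (hc : c % 4 = 1) (h : (p : ℤ) = x ^ 2 + 4 * y ^ 2) (h' : (p : ℤ) = c ^ 2 + 4 * a ^ 2) :
    x = c :=
  Int.eq_of_sq_eq_sq_of_emod_four hx hc (sq_eq_sq_of_prime_eq_sq_add_four_mul_sq hp h h')

theorem mainTheorem9 (p q : ℕ) [Fact p.Prime] (hq : 0 < q) (hp : p = 8 * q + 5)
    (S : Set (ZMod p)) (hS : S.Nonempty) (m : ℕ) (g : Fin m ≃ S) :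
    (S = residues p 4 → (∃ a : ℤ, Odd a ∧ (p : ℤ) = 4 * a ^ 2 + 1) →
      IsETF (harmonicFrame g)) ∧
    (S = residues p 4 ∪ {0} → (∃ a : ℤ, Odd a ∧ (p : ℤ) = 4 * a ^ 2 + 9) →
      IsETF (harmonicFrame g)) ∧
    (S = residues p 4 →
      (∃ a : ℤ, (p : ℤ) = 9 + 4 * a ^ 2 ∨ (p : ℤ) = 25 + 4 * a ^ 2) →
      IsBTF (harmonicFrame g) ∧
      frameAngles (harmonicFrame g) =
        {1 / ((p : ℝ) - 1) * Real.sqrt (3 * (p : ℝ) + 1 + 8 * Real.sqrt (p : ℝ)),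
         1 / ((p : ℝ) - 1) * Real.sqrt (3 * (p : ℝ) + 1 - 8 * Real.sqrt (p : ℝ))} ∧
      HasMultiplicity (harmonicFrame g)
        (1 / ((p : ℝ) - 1) * Real.sqrt (3 * (p : ℝ) + 1 + 8 * Real.sqrt (p : ℝ)))
        ((p - 1) / 2) ∧
      HasMultiplicity (harmonicFrame g)
        (1 / ((p : ℝ) - 1) * Real.sqrt (3 * (p : ℝ) + 1 - 8 * Real.sqrt (p : ℝ)))
        ((p - 1) / 2)) ∧
    (S = residues p 4 ∪ {0} →
      (∃ a : ℤ, (p : ℤ) = 1 + 4 * a ^ 2 ∨ (p : ℤ) = 49 + 4 * a ^ 2) →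
      IsBTF (harmonicFrame g) ∧
      frameAngles (harmonicFrame g) =
        {1 / ((p : ℝ) + 3) * Real.sqrt (3 * (p : ℝ) + 9 + 8 * Real.sqrt (p : ℝ)),
         1 / ((p : ℝ) + 3) * Real.sqrt (3 * (p : ℝ) + 9 - 8 * Real.sqrt (p : ℝ))} ∧
      HasMultiplicity (harmonicFrame g)
        (1 / ((p : ℝ) + 3) * Real.sqrt (3 * (p : ℝ) + 9 + 8 * Real.sqrt (p : ℝ)))
        ((p - 1) / 2) ∧
      HasMultiplicity (harmonicFrame g)
        (1 / ((p : ℝ) + 3) * Real.sqrt (3 * (p : ℝ) + 9 - 8 * Real.sqrt (p : ℝ)))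
        ((p - 1) / 2)) := by
  obtain ⟨x, y, ε, hx, hxy, hε, h0, hsum, hframe⟩ := exists_norm_inner_harmonicFrame hp
  have hpr : p.Prime := Fact.out
  have hp3 : 3 ≤ p := by omega
  have hpR : (3 : ℝ) ≤ p := by exact_mod_cast hp3
  have hs : 0 < √(p : ℝ) := Real.sqrt_pos.2 (by linarith)
  have hres : S = residues p 4 → m ≠ 0 ∧ ∀ a b, a ≠ b →
      ‖inner ℂ (harmonicFrame g a) (harmonicFrame g b)‖ =
        1 / ((p : ℝ) - 1) * √(3 * p + 1 + ε (b - a) * (2 * (x - 1) * √p)) := by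
    rintro rfl
    simpa using hframe 0 _ m g fun F => by simp [sum_comp_enumeration]
  have hres0 : S = residues p 4 ∪ {0} → m ≠ 0 ∧ ∀ a b, a ≠ b →
      ‖inner ℂ (harmonicFrame g a) (harmonicFrame g b)‖ =
        1 / ((p : ℝ) + 3) * √(3 * p + 9 + ε (b - a) * (2 * (x + 3) * √p)) := by
    rintro rfl
    have h := hframe 4 _ m g fun F => by
      rw [sum_enumeration_residues_union_zero, mul_add, Nat.cast_ofNat]
    refine ⟨h.1, fun a b hab => ?_⟩
    rw [h.2 a b hab, Nat.cast_ofNat]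
    ring_nf
  -- The condition x ≡ 1 mod 4 fixes the sign of the root: the squares 1, 9, 25, 49 give x = 1, -3,
  -- 5, -7. Then x - 1 (without zero) or x + 3 (with zero) is 0 in the equiangular cases and ±4 in
  -- the biangular ones.
  refine ⟨fun hS ha => ?_, fun hS ha => ?_, fun hS ha => ?_, fun hS ha => ?_⟩
  · obtain ⟨a, -, ha⟩ := ha
    obtain rfl : x = 1 := eq_of_prime_eq_sq_add_four_mul_sq hpr hx (a := a) rfl hxy (by linarith)
    obtain ⟨hm, h⟩ := hres hS
    exact isETF_harmonicFrame hpr.one_lt hm g fun a b hab => (h a b hab).trans (by simp; rfl)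
  · obtain ⟨a, -, ha⟩ := ha
    obtain rfl : x = -3 := eq_of_prime_eq_sq_add_four_mul_sq hpr hx (a := a) rfl hxy (by linarith)
    obtain ⟨hm, h⟩ := hres0 hS
    exact isETF_harmonicFrame hpr.one_lt hm g fun a b hab => (h a b hab).trans (by simp; rfl)
  · obtain ⟨hm, h⟩ := hres hS
    refine biangular_harmonicFrame_of_sqrt hp3 hm g hε h0 hsum (by linarith) (by linarith)
      (by linarith) ?_ h
    obtain ⟨a, ha | ha⟩ := ha
    · obtain rfl : x = -3 := eq_of_prime_eq_sq_add_four_mul_sq hpr hx (a := a) rfl hxy (by linarith)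
      right; push_cast; ring
    · obtain rfl : x = 5 := eq_of_prime_eq_sq_add_four_mul_sq hpr hx (a := a) rfl hxy (by linarith)
      left; push_cast; ring
  · obtain ⟨hm, h⟩ := hres0 hS
    refine biangular_harmonicFrame_of_sqrt hp3 hm g hε h0 hsum (by linarith) (by linarith)
      (by linarith) ?_ h
    obtain ⟨a, ha | ha⟩ := ha
    · obtain rfl : x = 1 := eq_of_prime_eq_sq_add_four_mul_sq hpr hx (a := a) rfl hxy (by linarith)
      left; push_cast; ring
    · obtain rfl : x = -7 := eq_of_prime_eq_sq_add_four_mul_sq hpr hx (a := a) rfl hxy (by linarith)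
      right; push_cast; ring
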